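/- Let $\mathcal X,\mathcal Y_2,\mathcal Z_2$ be finite alphabets, and let $X\to Y_2$ and $X\to Z_2$ be discrete memoryless channels with transition probabilities $p(y_2|x)$ and $p(z_2|x)$. Suppose that $Z_2$ is less noisy than $Y_2$, i.e. $I(U;Y_2)\le I(U;Z_2)$ for every finite-valued $U$ and every joint law $p(u,x)$ such that $U\to X\to(Y_2,Z_2)$ is a Markov chain. Then $Z_2$ is a better receiver than $Y_2$: for every channel $X\to Y_1$ with finite output alphabet, the capacity region of the broadcast channel $X\to(Y_1,Z_2)$ contains the capacity region of the broadcast channel $X\to(Y_1,Y_2)$. This holds for any two broadcast channels $p(y_1,y_2|x)$ and $p(y_1,z_2|x)$ with the given marginals $p(y_1|x)$, $p(y_2|x)$ and $p(y_1|x)$, $p(z_2|x)$, respectively. Here a $((2^{nR_1},2^{nR_2}),n)$ code for a broadcast channel $X\to(Y_1,Y_2)$ consists of an encoder mapping pairs of messages, from sets of sizes $\lceil 2^{nR_1}\rceil$ and $\lceil 2^{nR_2}\rceil$, to $\mathcal X^n$, and two decoders that estimate the first message from $Y_1^n$ and the second message from $Y_2^n$. Its error probability $P_e^{(n)}$ is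 the probability that at least one of the two estimates is wrong, when the message pair is uniformly distributed and the channel is used $n$ times without memory. A pair $(R_1,R_2)$ with $R_1,R_2\ge 0$ is achievable if there is a sequence of such codes with $P_e^{(n)}\to 0$ as $n\to\infty$, and the capacity region is the closure of the set of achievable pairs. -/

import Mathlib

universe u v v' w

namespace BroadcastChannel

/-- A discrete memoryless channel `X → Y` with finite output alphabet: for every input letter `x`,
a probability mass function `W x` on `Y`, where `W x y = p(y|x)`. -/
abbrev Channel (X Y : Type*) [Fintype Y] := X → stdSimplex ℝ Y

/-- The first marginal `p(y₁|x)` of the broadcast channel `p(y₁,y₂|x)` is the channel `F`. -/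
def HasFstMarginal {X Y₁ Y₂ : Type*} [Fintype Y₁] [Fintype Y₂]
    (W : Channel X (Y₁ × Y₂)) (F : Channel X Y₁) : Prop :=
  ∀ x y₁, ∑ y₂, W x (y₁, y₂) = F x y₁

/-- The second marginal `p(y₂|x)` of the broadcast channel `p(y₁,y₂|x)` is the channel `F`. -/
def HasSndMarginal {X Y₁ Y₂ : Type*} [Fintype Y₁] [Fintype Y₂]
    (W : Channel X (Y₁ × Y₂)) (F : Channel X Y₂) : Prop :=
  ∀ x y₂, ∑ y₁, W x (y₁, y₂) = F x y₂

/-- An `((M₁, M₂), n)` code for a broadcast channel `X → (Y₁, Y₂)`: one encoder and two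
decoders. -/
structure Code (X Y₁ Y₂ : Type*) (M₁ M₂ n : ℕ) where
  /-- the encoder -/
  enc : Fin M₁ × Fin M₂ → (Fin n → X)
  /-- the decoder of receiver 1 -/
  dec₁ : (Fin n → Y₁) → Fin M₁
  /-- the decoder of receiver 2 -/
  dec₂ : (Fin n → Y₂) → Fin M₂

/-- The probability that at least one receiver decodes its message wrongly, when the message pair
is uniformly distributed and the channel is used `n` times without memory. -/
noncomputable def Code.errorProb {X Y₁ Y₂ : Type*} [Fintype Y₁] [Fintype Y₂] {M₁ M₂ n : ℕ}
    (c : Code X Y₁ Y₂ M₁ M₂ n) (W : Channel X (Y₁ × Y₂)) : ℝ :=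
  ((M₁ : ℝ) * (M₂ : ℝ))⁻¹ *
    ∑ m : Fin M₁ × Fin M₂, ∑ y₁ : Fin n → Y₁, ∑ y₂ : Fin n → Y₂,
      if c.dec₁ y₁ ≠ m.1 ∨ c.dec₂ y₂ ≠ m.2 then ∏ i, W (c.enc m i) (y₁ i, y₂ i) else 0

/-- The size `⌈2 ^ (n R)⌉` of the message set of a code of rate `R` and block length `n`. -/
noncomputable def numMessages (R : ℝ) (n : ℕ) : ℕ := ⌈(2 : ℝ) ^ ((n : ℝ) * R)⌉₊

/-- A pair of nonnegative rates is achievable if some sequence of `((2^{nR₁}, 2^{nR₂}), n)` codes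
has error probability tending to `0`. -/
def IsAchievable {X Y₁ Y₂ : Type*} [Fintype Y₁] [Fintype Y₂]
    (W : Channel X (Y₁ × Y₂)) (R : ℝ × ℝ) : Prop :=
  0 ≤ R.1 ∧ 0 ≤ R.2 ∧
    ∃ c : ∀ n : ℕ, Code X Y₁ Y₂ (numMessages R.1 n) (numMessages R.2 n) n,
      Filter.Tendsto (fun n => (c n).errorProb W) Filter.atTop (nhds 0)

/-- The capacity region: the closure of the set of achievable rate pairs. -/
def capacityRegion {X Y₁ Y₂ : Type*} [Fintype Y₁] [Fintype Y₂]
    (W : Channel X (Y₁ × Y₂)) : Set (ℝ × ℝ) :=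
  closure {R | IsAchievable W R}

/-- The mutual information `I(U;Y)`, in bits, of a joint probability mass function `q(u,y)`
on finite alphabets; terms with `q(u,y) = 0` vanish. -/
noncomputable def mutualInfo {U Y : Type*} [Fintype U] [Fintype Y] (q : U → Y → ℝ) : ℝ :=
  ∑ u, ∑ y, q u y * Real.logb 2 (q u y / ((∑ y', q u y') * (∑ u', q u' y)))

/-- The joint law `p(u,y) = ∑ₓ p(u,x) p(y|x)` of `(U,Y)` when `U → X → Y` is a Markov chain,
`(U,X)` has law `p`, and `Y` is the output of the channel `W` with input `X`. -/
noncomputable def outputLaw {U X Y : Type*} [Fintype U] [Fintype X] [Fintype Y]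
    (p : stdSimplex ℝ (U × X)) (W : Channel X Y) : U → Y → ℝ :=
  fun u y => ∑ x, p (u, x) * W x y

/-- `LessNoisy F G`: the receiver with channel `F : X → Z` is less noisy than the one with channel
`G : X → Y`, i.e. `I(U;Y) ≤ I(U;Z)` for every Markov chain `U → X → (Y,Z)` with finite `U`. -/
def LessNoisy {X Y Z : Type*} [Fintype X] [Fintype Y] [Fintype Z]
    (F : Channel X Z) (G : Channel X Y) : Prop :=
  ∀ (U : Type) [Fintype U] (p : stdSimplex ℝ (U × X)),
    mutualInfo (outputLaw p G) ≤ mutualInfo (outputLaw p F)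

/-- `BetterReceiver F₂ G₂`: the receiver with channel `F₂ : X → Z₂` is better than the one with
channel `G₂ : X → Y₂`, i.e. for every channel `F₁ : X → Y₁`, the capacity region of
`X → (Y₁, Z₂)` contains that of `X → (Y₁, Y₂)`. All broadcast channels with these
marginals are covered, whatever the dependence between their two outputs. -/
def BetterReceiver {X : Type u} {Y₂ : Type v} {Z₂ : Type v'}
    [Fintype Y₂] [Fintype Z₂] (F₂ : Channel X Z₂) (G₂ : Channel X Y₂) : Prop :=
  ∀ (Y₁ : Type w) [Fintype Y₁] (F₁ : Channel X Y₁)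
    (W : Channel X (Y₁ × Y₂)) (W' : Channel X (Y₁ × Z₂)),
    HasFstMarginal W F₁ → HasSndMarginal W G₂ →
    HasFstMarginal W' F₁ → HasSndMarginal W' F₂ →
      capacityRegion W ⊆ capacityRegion W'

end BroadcastChannel

namespace BroadcastChannel

open Finset Real Filter

/-! No single-letter form of the capacity region is needed: a good code for `W` is itself turned
into a channel to code over. Fix one block length `n` at which the given code has small error. Its
encoder followed by `n` channel uses is a memoryless channel with two inputs, the messages `M₁` and
`M₂`, taken uniform and independent. Fano's inequality bounds `I(M₁;Y₁ⁿ)` and `I(M₂;Y₂ⁿ)` below by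
nearly `nR₁` and `nR₂` bits (`channelInfo_messageChannel_ge`).

The less noisy order passes to blocks: outputs are exchanged one coordinate at a time while the
others are held fixed (`LessNoisy.negCondEntropy_block_le`). Since `M₂ → Xⁿ → (Y₂ⁿ, Z₂ⁿ)` is Markov,
`I(M₂;Y₂ⁿ) ≤ I(M₂;Z₂ⁿ)`, so the second receiver loses no information when it is replaced.

Random coding over these super-letters, each receiver treating the other's input as noise, achieves
all nonnegative rates below `I(M₁;Y₁ⁿ)/n` and `I(M₂;Z₂ⁿ)/n`, as well as rate zero
(`exists_two_user_code`, `exists_rate_below`). Thus `R` lowered by any `δ > 0`, and truncated at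
zero, is achievable for `W'`; the closure absorbs `δ`. -/

/-! ### Conditional entropy and the less noisy order -/

/-- Minus the conditional entropy `H(U|Y)`, in nats, of a nonnegative function `q(u,y)`. -/
noncomputable def negCondEntropy {U Y : Type*} [Fintype U] [Fintype Y] (q : U → Y → ℝ) : ℝ :=
  ∑ y, (negMulLog (∑ u, q u y) - ∑ u, negMulLog (q u y))

lemma mutualInfo_mul_log_two {U Y : Type*} [Fintype U] [Fintype Y] (q : U → Y → ℝ)
    (hq : ∀ u y, 0 ≤ q u y) :
    mutualInfo q * log 2 = negCondEntropy q + ∑ u, negMulLog (∑ y, q u y) := by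
  have hlog2 : log 2 ≠ 0 := (log_pos one_lt_two).ne'
  have key : ∀ u y, q u y * logb 2 (q u y / ((∑ y', q u y') * (∑ u', q u' y))) * log 2 =
      -negMulLog (q u y) - q u y * log (∑ y', q u y') - q u y * log (∑ u', q u' y) := by
    intro u y
    rcases (hq u y).eq_or_lt with h | h
    · simp [← h]
    · have h1 : 0 < ∑ y', q u y' :=
        h.trans_le (single_le_sum (f := fun y' => q u y') (fun i _ => hq u i) (mem_univ y))
      have h2 : 0 < ∑ u', q u' y :=
        h.trans_le (single_le_sum (f := fun u' => q u' y) (fun i _ => hq i y) (mem_univ u))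
      rw [logb, log_div h.ne' (mul_pos h1 h2).ne', log_mul h1.ne' h2.ne', negMulLog]
      field_simp
      ring
  have h1 : ∑ u, ∑ y, q u y * log (∑ y', q u y') = -∑ u, negMulLog (∑ y, q u y) := by
    rw [← sum_neg_distrib]
    refine sum_congr rfl fun u _ => ?_
    rw [← sum_mul, negMulLog]; ring
  have h2 : ∑ u, ∑ y, q u y * log (∑ u', q u' y) = -∑ y, negMulLog (∑ u, q u y) := by
    rw [sum_comm, ← sum_neg_distrib]
    refine sum_congr rfl fun u _ => ?_
    rw [← sum_mul, negMulLog]; ring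
  have h3 : mutualInfo q * log 2 = ∑ u, ∑ y, (-negMulLog (q u y) -
      q u y * log (∑ y', q u y') - q u y * log (∑ u', q u' y)) := by
    rw [mutualInfo, sum_mul]
    refine sum_congr rfl fun u _ => ?_
    rw [sum_mul]
    exact sum_congr rfl fun y _ => key u y
  rw [h3]
  simp only [sum_sub_distrib, h1, h2, negCondEntropy, sum_neg_distrib]
  rw [sum_comm (f := fun u y => negMulLog (q u y))]
  ring

/-- In `I(U;Y) = H(U) - H(U|Y)` the term `H(U)` does not depend on the channel, so comparing
informations amounts to comparing conditional entropies. -/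
lemma mutualInfo_outputLaw_mul_log_two {U X Y : Type*} [Fintype U] [Fintype X] [Fintype Y]
    (p : stdSimplex ℝ (U × X)) (K : Channel X Y) :
    mutualInfo (outputLaw p K) * log 2 =
      negCondEntropy (outputLaw p K) + ∑ u, negMulLog (∑ x, p (u, x)) := by
  rw [mutualInfo_mul_log_two (outputLaw p K) fun u y =>
    sum_nonneg fun x _ => mul_nonneg (p.2.1 (u, x)) ((K x).2.1 y)]
  congr 1
  refine sum_congr rfl fun u _ => ?_
  simp only [outputLaw]
  rw [sum_comm]
  congr 1
  refine sum_congr rfl fun x _ => ?_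
  rw [← mul_sum]
  have : ∑ y, K x y = 1 := (K x).2.2
  rw [this, mul_one]

lemma negCondEntropy_mul {U Y : Type*} [Fintype U] [Fintype Y] (c : ℝ) (q : U → Y → ℝ) :
    negCondEntropy (fun u y => c * q u y) = c * negCondEntropy q := by
  simp only [negCondEntropy, ← mul_sum, negMulLog_mul, sum_add_distrib, ← sum_mul]
  rw [mul_sum]
  refine sum_congr rfl fun y _ => ?_
  ring

/-- Both sides are homogeneous of degree one, so normalising `q` costs nothing. Dropping the
normalisation lets this apply to slices of a joint law at a fixed output. -/
lemma LessNoisy.negCondEntropy_le {X Y Z : Type*} [Fintype X] [Fintype Y] [Fintype Z]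
    {F : Channel X Z} {G : Channel X Y} (h : LessNoisy F G) (U : Type) [Fintype U]
    (q : U → X → ℝ) (hq : ∀ u x, 0 ≤ q u x) :
    negCondEntropy (fun u y => ∑ x, q u x * G x y) ≤
      negCondEntropy (fun u z => ∑ x, q u x * F x z) := by
  have hS : 0 ≤ ∑ u, ∑ x, q u x := sum_nonneg fun u _ => sum_nonneg fun x _ => hq u x
  set S := ∑ u, ∑ x, q u x with hSdef
  rcases hS.eq_or_lt with h0 | h0
  · have hz : ∀ u x, q u x = 0 := by
      intro u x
      have h1 := (sum_eq_zero_iff_of_nonneg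
        (fun u _ => sum_nonneg fun x _ => hq u x)).1 (hSdef ▸ h0.symm) u (mem_univ u)
      exact (sum_eq_zero_iff_of_nonneg (fun x _ => hq u x)).1 h1 x (mem_univ x)
    simp [hz, negCondEntropy]
  · let p : stdSimplex ℝ (U × X) := ⟨fun a => S⁻¹ * q a.1 a.2,
      fun a => mul_nonneg (inv_nonneg.2 hS) (hq _ _), by
        rw [← mul_sum, Fintype.sum_prod_type, ← hSdef, inv_mul_cancel₀ h0.ne']⟩
    have hp : ∀ u x, p (u, x) = S⁻¹ * q u x := fun _ _ => rfl
    have h1 := mul_le_mul_of_nonneg_right (h U p) (log_pos one_lt_two).le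
    rw [mutualInfo_outputLaw_mul_log_two, mutualInfo_outputLaw_mul_log_two] at h1
    have h2 := le_of_add_le_add_right h1
    have hG : outputLaw p G = fun u y => S⁻¹ * ∑ x, q u x * G x y := by
      funext u y; simp only [outputLaw, hp, mul_assoc, mul_sum]
    have hF : outputLaw p F = fun u z => S⁻¹ * ∑ x, q u x * F x z := by
      funext u z; simp only [outputLaw, hp, mul_assoc, mul_sum]
    rw [hG, hF, negCondEntropy_mul, negCondEntropy_mul] at h2
    exact le_of_mul_le_mul_left h2 (inv_pos.2 h0)

lemma sum_fin_succ_fun {A : Type*} [Fintype A] {n : ℕ} (g : (Fin (n + 1) → A) → ℝ) :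
    ∑ y, g y = ∑ a, ∑ y : Fin n → A, g (Fin.cons a y) := by
  rw [← (Fin.consEquiv fun _ => A).sum_comp, Fintype.sum_prod_type]
  rfl

/-- The less noisy order is preserved by memoryless extension to blocks of length `n`. -/
lemma LessNoisy.negCondEntropy_block_le {X Y Z : Type*} [Fintype X] [Fintype Y] [Fintype Z]
    {F : Channel X Z} {G : Channel X Y} (h : LessNoisy F G) (U : Type) [Fintype U] (n : ℕ)
    (q : U → (Fin n → X) → ℝ) (hq : ∀ u x, 0 ≤ q u x) :
    negCondEntropy (fun u (y : Fin n → Y) => ∑ x, q u x * ∏ i, G (x i) (y i)) ≤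
      negCondEntropy (fun u (z : Fin n → Z) => ∑ x, q u x * ∏ i, F (x i) (z i)) := by
  induction n with
  | zero => simp [negCondEntropy]
  | succ n ih =>
    have hG : ∀ x y, 0 ≤ G x y := fun x y => (G x).2.1 y
    have hF : ∀ x y, 0 ≤ F x y := fun x y => (F x).2.1 y
    -- The last `n` outputs are frozen at `y`; only the first coordinate passes from `G` to `F`.
    have step1 : ∀ y : Fin n → Y, _ := fun y => h.negCondEntropy_le U
      (fun u a => ∑ x, q u (Fin.cons a x) * ∏ i, G (x i) (y i))
      (fun u a => sum_nonneg fun x _ => mul_nonneg (hq _ _) (prod_nonneg fun i _ => hG _ _))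
    -- The first output is now frozen at `z`, and the induction hypothesis exchanges the rest.
    -- Summed over `y` and over `z`, the two steps meet at the law with first output from `F` and
    -- the others from `G`.
    have step2 : ∀ z : Z, _ := fun z =>
      ih (fun u x => ∑ a, q u (Fin.cons a x) * F a z)
      (fun u x => sum_nonneg fun a _ => mul_nonneg (hq _ _) (hF _ _))
    have h1 := sum_le_sum fun y (_ : y ∈ univ) => step1 y
    have h2 := sum_le_sum fun z (_ : z ∈ univ) => step2 z
    simp only [negCondEntropy, sum_mul] at h1 h2 ⊢
    simp only [sum_fin_succ_fun, Fin.prod_univ_succ, Fin.cons_zero, Fin.cons_succ]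
    rw [sum_comm]
    refine le_trans (le_of_eq ?_) (h1.trans (le_trans (le_of_eq ?_) (h2.trans (le_of_eq ?_))))
    · simp only [mul_left_comm, mul_comm]
    · rw [sum_comm]
      refine sum_congr rfl fun z _ => sum_congr rfl fun y _ => ?_
      have : ∀ u, ∑ a, ∑ x : Fin n → X, q u (Fin.cons a x) * (∏ i, G (x i) (y i)) * F a z =
          ∑ x : Fin n → X, ∑ a, q u (Fin.cons a x) * F a z * ∏ i, G (x i) (y i) := by
        intro u
        rw [sum_comm]
        simp only [mul_assoc, mul_left_comm, mul_comm]
      simp only [this]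
    · refine sum_congr rfl fun z _ => sum_congr rfl fun y _ => ?_
      have : ∀ u, ∑ x : Fin n → X, ∑ a, q u (Fin.cons a x) * F a z * (∏ i, F (x i) (y i)) =
          ∑ a, ∑ x : Fin n → X, q u (Fin.cons a x) * (F a z * ∏ i, F (x i) (y i)) := by
        intro u
        rw [sum_comm]
        simp only [mul_assoc]
      simp only [this]

/-! ### Fano's inequality -/

/-- Fano's inequality. -/
lemma negCondEntropy_ge_of_decoder {U Y : Type*} [Fintype U] [DecidableEq U] [Nonempty U]
    [Fintype Y] (q : U → Y → ℝ) (hq : ∀ u y, 0 ≤ q u y) (hsum : ∑ u, ∑ y, q u y = 1)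
    (d : Y → U) :
    -log 2 - (∑ u, ∑ y, if d y ≠ u then q u y else 0) * log (Fintype.card U) ≤
      negCondEntropy q := by
  set M : ℝ := (Fintype.card U : ℝ) with hM
  have hM0 : 0 < M := by rw [hM]; exact_mod_cast Fintype.card_pos
  -- A guess at the law of `U` given `y`: mass `1/2` on the decoded value and `1/(2M)` on each other
  -- value. Its logarithms give the `log 2` and `log M` of the bound.
  let g : U → Y → ℝ := fun u y => if d y ≠ u then (2 * M)⁻¹ else 2⁻¹
  have hg0 : ∀ u y, 0 < g u y := fun u y => by simp only [g]; split_ifs <;> positivity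
  have hg1 : ∀ y, ∑ u, g u y ≤ 1 := by
    intro y
    have : ∀ u, g u y ≤ (2 * M)⁻¹ + if d y = u then 2⁻¹ else 0 := by
      intro u
      simp only [g]
      split_ifs <;> simp_all
    calc ∑ u, g u y ≤ ∑ u, ((2 * M)⁻¹ + if d y = u then 2⁻¹ else 0) := sum_le_sum fun u _ => this u
      _ = 1 := by
        rw [sum_add_distrib, sum_ite_eq, sum_const, card_univ, nsmul_eq_mul, ← hM]
        simp
        field_simp
        norm_num
  have hloc : ∀ u y, -(if d y ≠ u then q u y else 0) * log M - q u y * log 2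
      = q u y * log (g u y) := by
    intro u y
    simp only [g]
    split_ifs
    · rw [log_inv, log_mul two_ne_zero hM0.ne']; ring
    · rw [log_inv]; ring
  have hy : ∀ y, ∑ u, q u y * log (g u y) ≤
      negMulLog (∑ u, q u y) - ∑ u, negMulLog (q u y) := by
    intro y
    set s := ∑ u, q u y with hs
    have hs0 : 0 ≤ s := sum_nonneg fun u _ => hq u y
    -- Gibbs' inequality termwise: `log t ≤ t - 1` at `t = s * g u y / q u y`.
    have hterm : ∀ u, q u y * log (g u y) ≤
        -(q u y * log s) - negMulLog (q u y) + (s * g u y - q u y) := by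
      intro u
      rcases (hq u y).eq_or_lt with h | h
      · rw [← h]; simpa using mul_nonneg hs0 (hg0 u y).le
      · have hs1 : 0 < s :=
          h.trans_le (single_le_sum (f := fun u => q u y) (fun i _ => hq i y) (mem_univ u))
        have h1 := log_le_sub_one_of_pos (div_pos (mul_pos hs1 (hg0 u y)) h)
        rw [log_div (mul_pos hs1 (hg0 u y)).ne' h.ne', log_mul hs1.ne' (hg0 u y).ne'] at h1
        have h2 := mul_le_mul_of_nonneg_left h1 h.le
        rw [mul_sub (q u y) _ 1, mul_div_cancel₀ _ h.ne'] at h2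
        rw [negMulLog]
        linarith
    calc _ ≤ ∑ u, (-(q u y * log s) - negMulLog (q u y) + (s * g u y - q u y)) :=
          sum_le_sum fun u _ => hterm u
      _ = negMulLog s - ∑ u, negMulLog (q u y) + s * (∑ u, g u y - 1) := by
          simp only [sum_add_distrib, sum_sub_distrib, sum_neg_distrib, ← sum_mul, ← mul_sum, ← hs]
          rw [negMulLog]; ring
      _ ≤ _ := by
          have := mul_nonneg hs0 (sub_nonneg.2 (hg1 y))
          linarith
  calc _ = ∑ y, ∑ u, q u y * log (g u y) := by
        rw [sum_comm (s := univ) (t := univ) (f := fun y u => q u y * log (g u y))]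
        simp only [← hloc, sum_sub_distrib, ← sum_mul, sum_neg_distrib, hsum]
        ring
    _ ≤ _ := sum_le_sum fun y _ => hy y

/-! ### Random coding for one receiver -/

lemma sum_fun_prod {ι A : Type*} [Fintype ι] [DecidableEq ι] [Fintype A] (f : ι → A → ℝ) :
    ∑ x : ι → A, ∏ i, f i (x i) = ∏ i, ∑ a, f i a := by
  rw [Finset.prod_univ_sum, Fintype.piFinset_univ]

lemma sum_fun_prod_mul {ι A : Type*} [Fintype ι] [DecidableEq ι] [Fintype A] (w : A → ℝ)
    (hw : ∑ a, w a = 1) (m : ι) (h : A → ℝ) :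
    ∑ f : ι → A, (∏ j, w (f j)) * h (f m) = ∑ a, w a * h a := by
  have h1 : ∀ f : ι → A, (∏ j, w (f j)) * h (f m) =
      ∏ j, w (f j) * (if j = m then h (f j) else 1) := by
    intro f
    rw [prod_mul_distrib, prod_ite_eq' univ m]
    simp
  simp only [h1]
  rw [sum_fun_prod (fun j a => w a * (if j = m then h a else 1)),
    ← mul_prod_erase univ _ (mem_univ m), prod_eq_one, mul_one]
  · simp
  · intro j hj
    simp [ne_of_mem_erase hj, hw]

/-- Distinct codewords of an i.i.d. codebook are independent, and all remaining codewords integrate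
to one. -/
lemma sum_fun_prod_mul_mul {ι A : Type*} [Fintype ι] [DecidableEq ι] [Fintype A] (w : A → ℝ)
    (hw : ∑ a, w a = 1) {m m' : ι} (hm : m' ≠ m) (g h : A → ℝ) :
    ∑ f : ι → A, (∏ j, w (f j)) * (g (f m) * h (f m')) =
      (∑ a, w a * g a) * ∑ a, w a * h a := by
  have h1 : ∀ f : ι → A, (∏ j, w (f j)) * (g (f m) * h (f m')) =
      ∏ j, w (f j) * ((if j = m then g (f j) else 1) * (if j = m' then h (f j) else 1)) := by
    intro f
    rw [prod_mul_distrib, prod_mul_distrib, prod_ite_eq' univ m, prod_ite_eq' univ m']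
    simp
  simp only [h1]
  rw [sum_fun_prod (fun j a => w a * ((if j = m then g a else 1) * (if j = m' then h a else 1))),
    ← mul_prod_erase univ _ (mem_univ m),
    ← mul_prod_erase (univ.erase m) _ (mem_erase.2 ⟨hm, mem_univ m'⟩), prod_eq_one, mul_one]
  · simp [hm, hm.symm]
  · intro j hj
    simp [ne_of_mem_erase hj, ne_of_mem_erase (mem_of_mem_erase hj), hw]

/-- Decoding a random codebook with i.i.d. codewords by a test `T`: the expected error
probability of every message is at most the probability that the test misses the sent codeword,
plus the number of other messages times the probability that it accepts an independent one. -/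
lemma exists_random_decoder {A B : Type*} [Fintype A] [Fintype B] (w : A → ℝ)
    (hw0 : ∀ a, 0 ≤ w a) (hw1 : ∑ a, w a = 1) (κ : A → B → ℝ) (hκ : ∀ a b, 0 ≤ κ a b)
    (T : A → B → Prop) [∀ a b, Decidable (T a b)] {N : ℕ} (hN : 0 < N) :
    ∃ d : (Fin N → A) → B → Fin N, ∀ m,
      ∑ f : Fin N → A, (∏ j, w (f j)) * ∑ b, (if d f b ≠ m then κ (f m) b else 0) ≤
        ∑ a, w a * ∑ b, (if T a b then 0 else κ a b) +
          (N - 1) * ∑ b, (∑ a, w a * κ a b) * ∑ a, w a * (if T a b then 1 else 0) := by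
  classical
  -- Any accepted codeword may be chosen: an error then forces the sent codeword to be rejected or
  -- another one to be accepted.
  let d : (Fin N → A) → B → Fin N := fun f b =>
    if h : ∃ m, T (f m) b then h.choose else ⟨0, hN⟩
  refine ⟨d, fun m => ?_⟩
  have hd : ∀ f b, (if d f b ≠ m then κ (f m) b else 0) ≤
      (if T (f m) b then 0 else κ (f m) b) +
        ∑ m' ∈ univ.erase m, κ (f m) b * (if T (f m') b then 1 else 0) := by
    intro f b
    have hs : 0 ≤ ∑ m' ∈ univ.erase m, κ (f m) b * (if T (f m') b then 1 else 0) :=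
      sum_nonneg fun m' _ => mul_nonneg (hκ _ _) (by split_ifs <;> simp)
    by_cases hT : T (f m) b
    · by_cases hdm : d f b = m
      · simpa [hT, hdm] using hs
      · have hex : ∃ m, T (f m) b := ⟨m, hT⟩
        have hTd : T (f (d f b)) b := by
          simp only [d, dif_pos hex]
          exact hex.choose_spec
        rw [if_pos hdm, if_pos hT, zero_add]
        refine le_trans (le_of_eq ?_) (single_le_sum (a := d f b)
          (f := fun m' => κ (f m) b * (if T (f m') b then (1 : ℝ) else 0))
          (fun m' _ => mul_nonneg (hκ _ _) (by split_ifs <;> simp))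
          (mem_erase.2 ⟨hdm, mem_univ _⟩))
        simp [hTd]
    · rw [if_neg hT]
      have := hκ (f m) b
      split_ifs <;> linarith
  have hw : ∀ f : Fin N → A, 0 ≤ ∏ j, w (f j) := fun f => prod_nonneg fun j _ => hw0 _
  calc _ ≤ ∑ f : Fin N → A, (∏ j, w (f j)) * ∑ b, ((if T (f m) b then 0 else κ (f m) b) +
        ∑ m' ∈ univ.erase m, κ (f m) b * (if T (f m') b then 1 else 0)) :=
        sum_le_sum fun f _ => mul_le_mul_of_nonneg_left (sum_le_sum fun b _ => hd f b) (hw f)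
    _ = ∑ f : Fin N → A, (∏ j, w (f j)) * (∑ b, if T (f m) b then 0 else κ (f m) b) +
        ∑ m' ∈ univ.erase m, ∑ b, ∑ f : Fin N → A, (∏ j, w (f j)) *
          (κ (f m) b * (if T (f m') b then 1 else 0)) := by
        simp only [sum_add_distrib, mul_add, mul_sum]
        congr 1
        rw [sum_comm' (t' := univ) (s' := fun _ => univ) (by simp)]
        rw [sum_comm (s := univ.erase m)]
        refine sum_congr rfl fun b _ => ?_
        rw [sum_comm]
    _ = _ := by
        rw [sum_fun_prod_mul w hw1 m (fun a => ∑ b, if T a b then 0 else κ a b)]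
        congr 1
        rw [sum_congr rfl (g := fun _ => ∑ b, (∑ a, w a * κ a b) *
          ∑ a, w a * (if T a b then 1 else 0)), sum_const, card_erase_of_mem (mem_univ m),
          card_univ, Fintype.card_fin, nsmul_eq_mul, Nat.cast_sub hN, Nat.cast_one]
        intro m' hm'
        refine sum_congr rfl fun b _ => ?_
        rw [sum_fun_prod_mul_mul w hw1 (ne_of_mem_erase hm') (fun a => κ a b)
          (fun a => if T a b then 1 else 0)]

/-- A sum of exponentials with negative mean exponent is less than `1` at some positive scale. -/
lemma exists_sum_mul_exp_lt_one {ι : Type*} [Fintype ι] (p l : ι → ℝ) (hp : ∑ i, p i = 1)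
    (hl : ∑ i, p i * l i < 0) : ∃ s > 0, ∑ i, p i * exp (s * l i) < 1 := by
  by_contra! hcon
  -- The sum equals `1` at `s = 0`, with derivative the mean of `l`. If it stayed at least `1` for
  -- `s > 0`, the right slopes, hence the mean, would be nonnegative.
  have hder : HasDerivAt (fun s => ∑ i, p i * exp (s * l i)) (∑ i, p i * l i) 0 := by
    have := HasDerivAt.fun_sum (u := univ) (fun i (_ : i ∈ univ) =>
      (((hasDerivAt_id (0 : ℝ)).mul_const (l i)).exp).const_mul (p i))
    simpa using this
  have ht := hasDerivAt_iff_tendsto_slope.1 hder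
  have ht' := ht.mono_left (nhdsWithin_mono (0 : ℝ) (s := Set.Ioi 0) fun x hx => ne_of_gt hx)
  have : 0 ≤ ∑ i, p i * l i := by
    refine ge_of_tendsto ht' (Filter.eventually_of_mem self_mem_nhdsWithin fun s hs => ?_)
    have hs' : (0 : ℝ) < s := hs
    rw [slope_def_field]
    refine div_nonneg ?_ (by linarith)
    simpa [hp] using hcon s hs'
  linarith

/-- Mutual information, in nats, between the input with law `w` and the output of `κ`. -/
noncomputable def channelInfo {A B : Type*} [Fintype A] [Fintype B] (w : A → ℝ)
    (κ : A → B → ℝ) : ℝ :=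
  ∑ b, (negMulLog (∑ a, w a * κ a b) - ∑ a, w a * negMulLog (κ a b))

/-- Random coding for a memoryless channel: below the mutual information, the expected error
probability of i.i.d. codebooks of block length `k` decays exponentially. -/
lemma exists_random_decoder_memoryless {A B : Type*} [Fintype A] [Fintype B] (w : A → ℝ)
    (hw0 : ∀ a, 0 ≤ w a) (hw1 : ∑ a, w a = 1) (κ : A → B → ℝ) (hκ : ∀ a b, 0 ≤ κ a b)
    (hκ1 : ∀ a, ∑ b, κ a b = 1) (γ : ℝ)
    (hγ : γ < channelInfo w κ) :
    ∃ ρ : ℝ, 0 ≤ ρ ∧ ρ < 1 ∧ ∀ k N : ℕ, 0 < N →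
      ∃ d : (Fin N → Fin k → A) → (Fin k → B) → Fin N, ∀ m,
        ∑ f : Fin N → Fin k → A, (∏ j, ∏ i, w (f j i)) *
            ∑ b : Fin k → B, (if d f b ≠ m then ∏ i, κ (f m i) (b i) else 0) ≤
          ρ ^ k + (N - 1) * exp (-(k * γ)) := by
  classical
  set q : B → ℝ := fun b => ∑ a, w a * κ a b with hq
  -- `γ` minus the information density; its mean is `γ - I < 0`.
  let l : A × B → ℝ := fun x => γ + log (q x.2) - log (κ x.1 x.2)
  have hP : ∑ x : A × B, w x.1 * κ x.1 x.2 = 1 := by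
    simp [Fintype.sum_prod_type, ← mul_sum, hκ1, hw1]
  have hPl : ∑ x : A × B, w x.1 * κ x.1 x.2 * l x < 0 := by
    have : ∑ x : A × B, w x.1 * κ x.1 x.2 * l x =
        γ - channelInfo w κ := by
      have h1 : ∀ x : A × B, w x.1 * κ x.1 x.2 * l x = w x.1 * κ x.1 x.2 * γ +
          (w x.1 * κ x.1 x.2 * log (q x.2) + w x.1 * negMulLog (κ x.1 x.2)) := by
        intro x
        simp only [l, negMulLog]; ring
      simp only [h1, channelInfo]
      rw [sum_add_distrib, ← sum_mul, hP, one_mul, Fintype.sum_prod_type, sum_comm,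
        sub_eq_add_neg, ← sum_neg_distrib]
      congr 1
      refine sum_congr rfl fun b _ => ?_
      have h2 : ∑ a, w a * κ a b * log (q b) = q b * log (q b) := by rw [← sum_mul]
      rw [sum_add_distrib, h2, negMulLog]
      ring
    linarith
  obtain ⟨s, hs0, hs1⟩ := exists_sum_mul_exp_lt_one _ l hP hPl
  refine ⟨_, sum_nonneg fun x _ => mul_nonneg (mul_nonneg (hw0 _) (hκ _ _)) (exp_pos _).le, hs1,
    fun k N hN => ?_⟩
  -- Threshold test on the likelihood ratio, written without division so that zero probabilities are
  -- harmless.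
  let T : (Fin k → A) → (Fin k → B) → Prop := fun a b =>
    exp (k * γ) * ∏ i, q (b i) < ∏ i, κ (a i) (b i)
  obtain ⟨d, hd⟩ := exists_random_decoder (fun a : Fin k → A => ∏ i, w (a i))
    (fun a => prod_nonneg fun i _ => hw0 _) (by rw [sum_fun_prod (fun _ => w)]; simp [hw1])
    (fun a (b : Fin k → B) => ∏ i, κ (a i) (b i)) (fun a b => prod_nonneg fun i _ => hκ _ _) T hN
  refine ⟨d, fun m => (hd m).trans (add_le_add ?_ (mul_le_mul_of_nonneg_left ?_ ?_))⟩
  -- Chernoff bound: on pairs of positive probability, rejection means `∑ l ≥ 0`, so the factor `exp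
  -- (s * ∑ l)` is at least `1`. The sum then factors into a `k`-th power.
  · calc _ ≤ ∑ a : Fin k → A, ∑ b : Fin k → B,
          ∏ i, (w (a i) * κ (a i) (b i) * exp (s * l (a i, b i))) := by
          refine sum_le_sum fun a _ => ?_
          rw [mul_sum]
          refine sum_le_sum fun b _ => ?_
          have hnn : ∀ i, 0 ≤ w (a i) * κ (a i) (b i) := fun i => mul_nonneg (hw0 _) (hκ _ _)
          have hRHS : 0 ≤ ∏ i, (w (a i) * κ (a i) (b i) * exp (s * l (a i, b i))) :=
            prod_nonneg fun i _ => mul_nonneg (hnn i) (exp_pos _).le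
          split_ifs with hT
          · simpa using hRHS
          · rw [prod_mul_distrib, prod_mul_distrib]
            by_cases h0 : (∏ i, w (a i)) * ∏ i, κ (a i) (b i) = 0
            · simp [h0]
            refine le_mul_of_one_le_right
              (mul_nonneg (prod_nonneg fun i _ => hw0 _) (prod_nonneg fun i _ => hκ _ _)) ?_
            have hwpos : ∀ i, 0 < w (a i) := fun i => (hw0 _).lt_of_ne'
              (prod_ne_zero_iff.1 (left_ne_zero_of_mul h0) i (mem_univ i))
            have hκpos : ∀ i, 0 < κ (a i) (b i) := fun i => (hκ _ _).lt_of_ne'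
              (prod_ne_zero_iff.1 (right_ne_zero_of_mul h0) i (mem_univ i))
            have hqpos : ∀ i, 0 < q (b i) := fun i => (mul_pos (hwpos i) (hκpos i)).trans_le
              (single_le_sum (f := fun a => w a * κ a (b i))
                (fun a _ => mul_nonneg (hw0 a) (hκ a _)) (mem_univ (a i)))
            rw [← exp_sum, one_le_exp_iff, ← mul_sum]
            refine mul_nonneg hs0.le ?_
            have h1 := log_le_log (prod_pos fun i _ => hκpos i) (not_lt.1 hT)
            rw [log_mul (exp_pos _).ne' (prod_pos fun i _ => hqpos i).ne', log_exp,
              log_prod (fun i _ => (hκpos i).ne'), log_prod (fun i _ => (hqpos i).ne')] at h1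
            simp only [l, sum_sub_distrib, sum_add_distrib, sum_const, card_univ,
              Fintype.card_fin, nsmul_eq_mul]
            linarith
      _ = _ := by
          have h1 : ∀ a : Fin k → A, ∑ b : Fin k → B,
              ∏ i, (w (a i) * κ (a i) (b i) * exp (s * l (a i, b i))) =
              ∏ i, ∑ b, w (a i) * κ (a i) b * exp (s * l (a i, b)) := fun a =>
            sum_fun_prod (fun i b => w (a i) * κ (a i) b * exp (s * l (a i, b)))
          simp only [h1]
          rw [sum_fun_prod (fun _ a => ∑ b, w a * κ a b * exp (s * l (a, b)))]
          simp [Fintype.sum_prod_type]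
  · have hqb : ∀ b : Fin k → B, ∑ a : Fin k → A, (∏ i, w (a i)) * ∏ i, κ (a i) (b i) =
        ∏ i, q (b i) := by
      intro b
      simp only [← prod_mul_distrib]
      exact sum_fun_prod (fun i a => w a * κ a (b i))
    -- Change of measure: on accepted pairs the output law is at most `exp (-kγ)` times the
    -- conditional law.
    calc _ ≤ ∑ b : Fin k → B, ∑ a : Fin k → A,
          (∏ i, w (a i)) * (exp (-(k * γ)) * ∏ i, κ (a i) (b i)) := by
          refine sum_le_sum fun b _ => ?_
          rw [hqb, mul_sum]
          refine sum_le_sum fun a _ => ?_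
          rw [mul_left_comm]
          refine mul_le_mul_of_nonneg_left ?_ (prod_nonneg fun i _ => hw0 _)
          split_ifs with hT
          · rw [mul_one, exp_neg, inv_mul_eq_div, le_div_iff₀' (exp_pos _)]
            exact hT.le
          · rw [mul_zero]
            exact mul_nonneg (exp_pos _).le (prod_nonneg fun i _ => hκ _ _)
      _ = exp (-(k * γ)) := by
          simp only [mul_left_comm _ (exp (-(k * γ))), ← mul_sum]
          rw [sum_congr rfl fun b _ => hqb b, sum_fun_prod (fun _ b => q b)]
          have : ∑ b, q b = 1 := by
            simp only [hq]
            rw [sum_comm]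
            simp [← mul_sum, hκ1, hw1]
          simp [this]
  · have : (1 : ℝ) ≤ N := by exact_mod_cast hN
    linarith

/-! ### Two receivers, one pair of codebooks -/

lemma exists_le_of_sum_mul_le {ι : Type*} [Fintype ι] (p e : ι → ℝ) (hp : ∀ i, 0 ≤ p i)
    (hp1 : ∑ i, p i = 1) {B : ℝ} (h : ∑ i, p i * e i ≤ B) : ∃ i, e i ≤ B := by
  by_contra! hcon
  have h0 : ∑ i, p i * (e i - B) ≤ 0 := by
    simp only [mul_sub, sum_sub_distrib, ← sum_mul, hp1]
    linarith
  have h1 : ∀ i ∈ univ, 0 ≤ p i * (e i - B) := fun i _ =>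
    mul_nonneg (hp i) (sub_nonneg.2 (hcon i).le)
  have h2 := (sum_eq_zero_iff_of_nonneg h1).1 (le_antisymm h0 (sum_nonneg h1))
  have h3 : ∑ i, p i = 0 := sum_eq_zero fun i hi =>
    (mul_eq_zero.1 (h2 i hi)).resolve_right (sub_pos.2 (hcon i)).ne'
  linarith

/-- Averaging the error of a receiver over the i.i.d. codebook of the other message turns the
other message into memoryless noise. -/
lemma sum_codebook_mul_error {A C B : Type*} [Fintype A] [Fintype C] [Fintype B] (w : C → ℝ)
    (hw1 : ∑ c, w c = 1) (K : A → C → B → ℝ) {k N : ℕ} (S : (Fin k → B) → Prop)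
    [DecidablePred S] (a : Fin k → A) (m : Fin N) :
    ∑ g : Fin N → Fin k → C, (∏ j, ∏ i, w (g j i)) *
        ∑ b : Fin k → B, (if S b then ∏ i, K (a i) (g m i) (b i) else 0) =
      ∑ b : Fin k → B, if S b then ∏ i, ∑ c, w c * K (a i) c (b i) else 0 := by
  rw [sum_fun_prod_mul (fun c : Fin k → C => ∏ i, w (c i))
    (by rw [sum_fun_prod (fun _ => w)]; simp [hw1]) m
    (fun c => ∑ b : Fin k → B, (if S b then ∏ i, K (a i) (c i) (b i) else 0))]
  simp only [mul_sum]
  rw [sum_comm]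
  refine sum_congr rfl fun b _ => ?_
  split_ifs
  · simp only [← prod_mul_distrib]
    exact sum_fun_prod (fun i c => w c * K (a i) c (b i))
  · simp

/-- Coding for two receivers of a memoryless channel with two independent inputs, each receiver
treating the input not meant for it as noise. -/
lemma exists_two_user_code {A C B₁ B₂ : Type*} [Fintype A] [Fintype C] [Fintype B₁] [Fintype B₂]
    (w₁ : A → ℝ) (hw₁0 : ∀ a, 0 ≤ w₁ a) (hw₁1 : ∑ a, w₁ a = 1)
    (w₂ : C → ℝ) (hw₂0 : ∀ c, 0 ≤ w₂ c) (hw₂1 : ∑ c, w₂ c = 1)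
    (K₁ : A → C → B₁ → ℝ) (hK₁0 : ∀ a c b, 0 ≤ K₁ a c b) (hK₁1 : ∀ a c, ∑ b, K₁ a c b = 1)
    (K₂ : A → C → B₂ → ℝ) (hK₂0 : ∀ a c b, 0 ≤ K₂ a c b) (hK₂1 : ∀ a c, ∑ b, K₂ a c b = 1)
    (γ₁ γ₂ : ℝ) (hγ₁ : γ₁ < channelInfo w₁ fun a b => ∑ c, w₂ c * K₁ a c b)
    (hγ₂ : γ₂ < channelInfo w₂ fun c b => ∑ a, w₁ a * K₂ a c b) :
    ∃ ρ₁ ρ₂ : ℝ, 0 ≤ ρ₁ ∧ ρ₁ < 1 ∧ 0 ≤ ρ₂ ∧ ρ₂ < 1 ∧ ∀ k N₁ N₂ : ℕ, 0 < N₁ → 0 < N₂ →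
      ∃ (f : Fin N₁ → Fin k → A) (g : Fin N₂ → Fin k → C) (d₁ : (Fin k → B₁) → Fin N₁)
        (d₂ : (Fin k → B₂) → Fin N₂),
        ((N₁ : ℝ) * N₂)⁻¹ * ∑ m : Fin N₁ × Fin N₂,
          (∑ b : Fin k → B₁, (if d₁ b ≠ m.1 then ∏ i, K₁ (f m.1 i) (g m.2 i) (b i) else 0) +
            ∑ b : Fin k → B₂, (if d₂ b ≠ m.2 then ∏ i, K₂ (f m.1 i) (g m.2 i) (b i) else 0)) ≤
          (ρ₁ ^ k + (N₁ - 1) * exp (-(k * γ₁))) + (ρ₂ ^ k + (N₂ - 1) * exp (-(k * γ₂))) := by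
  obtain ⟨ρ₁, h₁0, h₁1, H₁⟩ := exists_random_decoder_memoryless w₁ hw₁0 hw₁1
    (fun a b => ∑ c, w₂ c * K₁ a c b)
    (fun a b => sum_nonneg fun c _ => mul_nonneg (hw₂0 c) (hK₁0 a c b))
    (fun a => by rw [sum_comm]; simp [← mul_sum, hK₁1, hw₂1]) γ₁ hγ₁
  obtain ⟨ρ₂, h₂0, h₂1, H₂⟩ := exists_random_decoder_memoryless w₂ hw₂0 hw₂1
    (fun c b => ∑ a, w₁ a * K₂ a c b)
    (fun c b => sum_nonneg fun a _ => mul_nonneg (hw₁0 a) (hK₂0 a c b))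
    (fun c => by rw [sum_comm]; simp [← mul_sum, hK₂1, hw₁1]) γ₂ hγ₂
  refine ⟨ρ₁, ρ₂, h₁0, h₁1, h₂0, h₂1, fun k N₁ N₂ hN₁ hN₂ => ?_⟩
  obtain ⟨d₁, hd₁⟩ := H₁ k N₁ hN₁
  obtain ⟨d₂, hd₂⟩ := H₂ k N₂ hN₂
  set β₁ := ρ₁ ^ k + (N₁ - 1) * exp (-(k * γ₁))
  set β₂ := ρ₂ ^ k + (N₂ - 1) * exp (-(k * γ₂))
  let p₁ : (Fin N₁ → Fin k → A) → ℝ := fun f => ∏ j, ∏ i, w₁ (f j i)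
  let p₂ : (Fin N₂ → Fin k → C) → ℝ := fun g => ∏ j, ∏ i, w₂ (g j i)
  have hp₁ : ∑ f, p₁ f = 1 := by
    simp only [p₁]
    rw [sum_fun_prod (fun _ (c : Fin k → A) => ∏ i, w₁ (c i)), sum_fun_prod (fun _ => w₁)]
    simp [hw₁1]
  have hp₂ : ∑ g, p₂ g = 1 := by
    simp only [p₂]
    rw [sum_fun_prod (fun _ (c : Fin k → C) => ∏ i, w₂ (c i)), sum_fun_prod (fun _ => w₂)]
    simp [hw₂1]
  let e₁ : Fin N₁ × Fin N₂ → (Fin N₁ → Fin k → A) × (Fin N₂ → Fin k → C) → ℝ := fun m x =>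
    ∑ b : Fin k → B₁, if d₁ x.1 b ≠ m.1 then ∏ i, K₁ (x.1 m.1 i) (x.2 m.2 i) (b i) else 0
  let e₂ : Fin N₁ × Fin N₂ → (Fin N₁ → Fin k → A) × (Fin N₂ → Fin k → C) → ℝ := fun m x =>
    ∑ b : Fin k → B₂, if d₂ x.2 b ≠ m.2 then ∏ i, K₂ (x.1 m.1 i) (x.2 m.2 i) (b i) else 0
  have he₁ : ∀ m, ∑ x : (Fin N₁ → Fin k → A) × (Fin N₂ → Fin k → C),
      p₁ x.1 * p₂ x.2 * e₁ m x ≤ β₁ := by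
    intro m
    refine (le_of_eq ?_).trans (hd₁ m.1)
    rw [Fintype.sum_prod_type]
    refine sum_congr rfl fun f _ => ?_
    simp only [mul_assoc, ← mul_sum]
    congr 1
    exact sum_codebook_mul_error w₂ hw₂1 K₁ (fun b => d₁ f b ≠ m.1) (f m.1) m.2
  have he₂ : ∀ m, ∑ x : (Fin N₁ → Fin k → A) × (Fin N₂ → Fin k → C),
      p₁ x.1 * p₂ x.2 * e₂ m x ≤ β₂ := by
    intro m
    refine (le_of_eq ?_).trans (hd₂ m.2)
    rw [Fintype.sum_prod_type, sum_comm]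
    refine sum_congr rfl fun g _ => ?_
    simp only [mul_comm (p₁ _) (p₂ g), mul_assoc, ← mul_sum]
    congr 1
    exact sum_codebook_mul_error w₁ hw₁1 (fun c a b => K₂ a c b) (fun b => d₂ g b ≠ m.2) (g m.2) m.1
  have hN : (0 : ℝ) < (N₁ : ℝ) * N₂ := by positivity
  -- The two errors are added before derandomising, so that one pair of codebooks serves both
  -- receivers.
  obtain ⟨⟨f, g⟩, hfg⟩ := exists_le_of_sum_mul_le (B := β₁ + β₂)
    (fun x : (Fin N₁ → Fin k → A) × (Fin N₂ → Fin k → C) => p₁ x.1 * p₂ x.2)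
    (fun x => ((N₁ : ℝ) * N₂)⁻¹ * ∑ m, (e₁ m x + e₂ m x))
    (fun x => mul_nonneg (prod_nonneg fun j _ => prod_nonneg fun i _ => hw₁0 _)
      (prod_nonneg fun j _ => prod_nonneg fun i _ => hw₂0 _))
    (by simp [Fintype.sum_prod_type, ← mul_sum, hp₁, hp₂]) (by
      simp only [mul_left_comm _ (((N₁ : ℝ) * N₂)⁻¹), ← mul_sum]
      rw [inv_mul_le_iff₀ hN]
      simp only [mul_sum]
      rw [sum_comm]
      calc _ ≤ ∑ m : Fin N₁ × Fin N₂, (β₁ + β₂) := sum_le_sum fun m _ => by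
            simp only [mul_add, sum_add_distrib]
            exact add_le_add (he₁ m) (he₂ m)
        _ = _ := by simp; ring)
  exact ⟨f, g, d₁ f, d₂ g, hfg⟩

/-! ### Padding, and errors through the marginals -/

/-- The probability that the decoder `d` does not return `m` when the codeword `x` is sent over
the memoryless channel `F`. -/
noncomputable def decodingError {X Y ι M : Type*} [Fintype Y] [Fintype ι] [DecidableEq ι]
    [DecidableEq M] (F : Channel X Y) (x : ι → X) (d : (ι → Y) → M) (m : M) : ℝ :=
  ∑ y : ι → Y, if d y ≠ m then ∏ i, F (x i) (y i) else 0

/-- The decoder ignores the `r` padded positions, whose outputs sum to one; the rest is `k`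
super-letters of length `n`. -/
lemma decodingError_pad {X Y ι M : Type*} [Fintype Y] [Fintype ι] [DecidableEq ι]
    [DecidableEq M] (F : Channel X Y) {k n r : ℕ} (e : (Fin k × Fin n) ⊕ Fin r ≃ ι)
    (x : Fin k → Fin n → X) (x₀ : X) (d : (Fin k → Fin n → Y) → M) (m : M) :
    decodingError F (fun t => Sum.elim (fun p => x p.1 p.2) (fun _ => x₀) (e.symm t))
        (fun y => d fun i j => y (e (Sum.inl (i, j)))) m =
      ∑ b : Fin k → Fin n → Y, if d b ≠ m then ∏ i, ∏ j, F (x i j) (b i j) else 0 := by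
  let E : (Fin k → Fin n → Y) × (Fin r → Y) ≃ (ι → Y) :=
    ((Equiv.curry (Fin k) (Fin n) Y).symm.prodCongr (Equiv.refl _)).trans
      ((Equiv.sumArrowEquivProdArrow _ _ _).symm.trans (e.arrowCongr (Equiv.refl Y)))
  have hEl : ∀ b p i j, E (b, p) (e (Sum.inl (i, j))) = b i j := by
    intro b p i j
    simp [E, Equiv.sumArrowEquivProdArrow, Equiv.arrowCongr]
  have hEr : ∀ b p i, E (b, p) (e (Sum.inr i)) = p i := by
    intro b p i
    simp [E, Equiv.sumArrowEquivProdArrow, Equiv.arrowCongr]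
  have h1 : ∑ y : Fin r → Y, ∏ i, F x₀ (y i) = 1 := by
    rw [sum_fun_prod (fun _ y => F x₀ y)]
    exact prod_eq_one fun i _ => (F x₀).2.2
  rw [decodingError, ← E.sum_comp, Fintype.sum_prod_type]
  refine sum_congr rfl fun b _ => ?_
  simp only [hEl]
  split_ifs
  · simp only [← e.prod_comp, Equiv.symm_apply_apply, Fintype.prod_sum_type, Sum.elim_inl,
      Sum.elim_inr, Fintype.prod_prod_type, hEl, hEr, ← mul_sum, h1, mul_one]
  · simp

section Marginals

variable {X Y₁ Y₂ : Type*} [Fintype Y₁] [Fintype Y₂] {W : Channel X (Y₁ × Y₂)}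
  {F₁ : Channel X Y₁} {F₂ : Channel X Y₂} {M₁ M₂ n : ℕ}

lemma HasFstMarginal.sum_prod (h : HasFstMarginal W F₁) (x : Fin n → X) (y₁ : Fin n → Y₁) :
    ∑ y₂ : Fin n → Y₂, ∏ i, W (x i) (y₁ i, y₂ i) = ∏ i, F₁ (x i) (y₁ i) := by
  rw [sum_fun_prod (fun i y₂ => W (x i) (y₁ i, y₂))]
  exact prod_congr rfl fun i _ => h _ _

lemma HasSndMarginal.sum_prod (h : HasSndMarginal W F₂) (x : Fin n → X) (y₂ : Fin n → Y₂) :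
    ∑ y₁ : Fin n → Y₁, ∏ i, W (x i) (y₁ i, y₂ i) = ∏ i, F₂ (x i) (y₂ i) := by
  rw [sum_fun_prod (fun i y₁ => W (x i) (y₁, y₂ i))]
  exact prod_congr rfl fun i _ => h _ _

/-- The event concerns one receiver only, so the other output sums out. This is why the dependence
between the two outputs is irrelevant. -/
lemma HasFstMarginal.sum_ite (h : HasFstMarginal W F₁) (c : Code X Y₁ Y₂ M₁ M₂ n)
    (m : Fin M₁ × Fin M₂) :
    ∑ y₁ : Fin n → Y₁, ∑ y₂ : Fin n → Y₂,
      (if c.dec₁ y₁ ≠ m.1 then ∏ i, W (c.enc m i) (y₁ i, y₂ i) else 0) =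
        decodingError F₁ (c.enc m) c.dec₁ m.1 := by
  refine sum_congr rfl fun y₁ _ => ?_
  split_ifs
  · exact h.sum_prod _ _
  · simp

lemma HasSndMarginal.sum_ite (h : HasSndMarginal W F₂) (c : Code X Y₁ Y₂ M₁ M₂ n)
    (m : Fin M₁ × Fin M₂) :
    ∑ y₁ : Fin n → Y₁, ∑ y₂ : Fin n → Y₂,
      (if c.dec₂ y₂ ≠ m.2 then ∏ i, W (c.enc m i) (y₁ i, y₂ i) else 0) =
        decodingError F₂ (c.enc m) c.dec₂ m.2 := by
  rw [sum_comm]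
  refine sum_congr rfl fun y₂ _ => ?_
  split_ifs
  · exact h.sum_prod _ _
  · simp

lemma prod_channel_nonneg (W : Channel X Y₁) (x : Fin n → X) (y : Fin n → Y₁) :
    0 ≤ ∏ i, W (x i) (y i) := prod_nonneg fun i _ => (W (x i)).2.1 (y i)

lemma HasFstMarginal.error_le (h : HasFstMarginal W F₁) (c : Code X Y₁ Y₂ M₁ M₂ n) :
    ((M₁ : ℝ) * M₂)⁻¹ * ∑ m, decodingError F₁ (c.enc m) c.dec₁ m.1 ≤ c.errorProb W := by
  refine mul_le_mul_of_nonneg_left (sum_le_sum fun m _ => ?_) (by positivity)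
  rw [← h.sum_ite c m]
  refine sum_le_sum fun y₁ _ => sum_le_sum fun y₂ _ => ?_
  have := prod_channel_nonneg W (c.enc m) (fun i => (y₁ i, y₂ i))
  split_ifs <;> first | exact le_rfl | exact this | simp_all

lemma HasSndMarginal.error_le (h : HasSndMarginal W F₂) (c : Code X Y₁ Y₂ M₁ M₂ n) :
    ((M₁ : ℝ) * M₂)⁻¹ * ∑ m, decodingError F₂ (c.enc m) c.dec₂ m.2 ≤ c.errorProb W := by
  refine mul_le_mul_of_nonneg_left (sum_le_sum fun m _ => ?_) (by positivity)
  rw [← h.sum_ite c m]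
  refine sum_le_sum fun y₁ _ => sum_le_sum fun y₂ _ => ?_
  have := prod_channel_nonneg W (c.enc m) (fun i => (y₁ i, y₂ i))
  split_ifs <;> first | exact le_rfl | exact this | simp_all

lemma errorProb_le_add (h₁ : HasFstMarginal W F₁) (h₂ : HasSndMarginal W F₂)
    (c : Code X Y₁ Y₂ M₁ M₂ n) :
    c.errorProb W ≤ ((M₁ : ℝ) * M₂)⁻¹ * ∑ m,
      (decodingError F₁ (c.enc m) c.dec₁ m.1 + decodingError F₂ (c.enc m) c.dec₂ m.2) := by
  refine mul_le_mul_of_nonneg_left (sum_le_sum fun m _ => ?_) (by positivity)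
  rw [← h₁.sum_ite c m, ← h₂.sum_ite c m, ← sum_add_distrib]
  refine sum_le_sum fun y₁ _ => ?_
  rw [← sum_add_distrib]
  refine sum_le_sum fun y₂ _ => ?_
  have := prod_channel_nonneg W (c.enc m) (fun i => (y₁ i, y₂ i))
  split_ifs <;> first | linarith | simp_all

lemma errorProb_nonneg (W : Channel X (Y₁ × Y₂)) (c : Code X Y₁ Y₂ M₁ M₂ n) :
    0 ≤ c.errorProb W := by
  refine mul_nonneg (by positivity) (sum_nonneg fun m _ => sum_nonneg fun y₁ _ =>
    sum_nonneg fun y₂ _ => ?_)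
  have := prod_channel_nonneg W (c.enc m) (fun i => (y₁ i, y₂ i))
  split_ifs
  · exact this
  · exact le_rfl

end Marginals

/-! ### Information carried by the messages of a code -/

lemma channelInfo_uniform {Y : Type*} [Fintype Y] {M : ℕ} (hM : 0 < M) (κ : Fin M → Y → ℝ)
    (hκ : ∀ u, ∑ y, κ u y = 1) :
    channelInfo (fun _ => (M : ℝ)⁻¹) κ = negCondEntropy (fun u y => (M : ℝ)⁻¹ * κ u y) + log M := by
  have hM' : (M : ℝ) ≠ 0 := by positivity
  have h1 : ∑ y, ∑ u, κ u y = M := by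
    rw [sum_comm]; simp [hκ]
  simp only [channelInfo, negCondEntropy, negMulLog_mul, sum_add_distrib, ← sum_mul,
    sum_sub_distrib, h1]
  rw [negMulLog, log_inv]
  field_simp
  ring

/-- The channel from a message `u` to the output block when the other message is uniform. -/
noncomputable def messageChannel {X Y : Type*} [Fintype Y] (F : Channel X Y) {M M' n : ℕ}
    (enc : Fin M → Fin M' → Fin n → X) (u : Fin M) (y : Fin n → Y) : ℝ :=
  ∑ c, (M' : ℝ)⁻¹ * ∏ i, F (enc u c i) (y i)

section MessageChannel

variable {X Y : Type*} [Fintype Y] {M M' n : ℕ} (F : Channel X Y)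
  (enc : Fin M → Fin M' → Fin n → X)

lemma messageChannel_nonneg (u : Fin M) (y : Fin n → Y) : 0 ≤ messageChannel F enc u y :=
  sum_nonneg fun _ _ => mul_nonneg (by positivity) (prod_channel_nonneg F _ y)

lemma sum_prod_channel (x : Fin n → X) : ∑ y : Fin n → Y, ∏ i, F (x i) (y i) = 1 := by
  rw [sum_fun_prod (fun i y => F (x i) y)]
  exact prod_eq_one fun i _ => (F (x i)).2.2

lemma sum_messageChannel (hM' : 0 < M') (u : Fin M) : ∑ y, messageChannel F enc u y = 1 := by
  have : (M' : ℝ) ≠ 0 := by positivity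
  simp only [messageChannel]
  rw [sum_comm]
  simp [← mul_sum, sum_prod_channel, this]

lemma channelInfo_messageChannel_ge (hM : 0 < M) (hM' : 0 < M') (d : (Fin n → Y) → Fin M) :
    log M - ((M : ℝ) * M')⁻¹ * (∑ u, ∑ c, decodingError F (enc u c) d u) * log M - log 2 ≤
      channelInfo (fun _ => (M : ℝ)⁻¹) (messageChannel F enc) := by
  have : Nonempty (Fin M) := ⟨⟨0, hM⟩⟩
  have hM0 : (M : ℝ) ≠ 0 := by positivity
  rw [channelInfo_uniform hM _ (sum_messageChannel F enc hM')]
  have h := negCondEntropy_ge_of_decoder (fun u y => (M : ℝ)⁻¹ * messageChannel F enc u y)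
    (fun u y => mul_nonneg (by positivity) (messageChannel_nonneg F enc u y))
    (by simp [← mul_sum, sum_messageChannel F enc hM', hM0]) d
  have h1 : (∑ u, ∑ y, if d y ≠ u then (M : ℝ)⁻¹ * messageChannel F enc u y else 0) =
      ((M : ℝ) * M')⁻¹ * ∑ u, ∑ c, decodingError F (enc u c) d u := by
    simp only [mul_sum, decodingError]
    refine sum_congr rfl fun u _ => ?_
    rw [sum_comm]
    refine sum_congr rfl fun y _ => ?_
    split_ifs
    · rw [messageChannel, mul_sum]
      exact sum_congr rfl fun c _ => by rw [mul_inv, mul_assoc]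
    · simp
  rw [h1, Fintype.card_fin] at h
  linarith

/-- Grouping the other messages by the codeword they produce exhibits the Markov chain from `u`
through `Xⁿ` to the output, the form to which the block comparison applies. -/
lemma negCondEntropy_messageChannel [Fintype X] [DecidableEq X] :
    negCondEntropy (fun u y => (M : ℝ)⁻¹ * messageChannel F enc u y) =
      negCondEntropy (fun u (y : Fin n → Y) => ∑ x : Fin n → X,
        (∑ c, if enc u c = x then (M : ℝ)⁻¹ * (M' : ℝ)⁻¹ else 0) * ∏ i, F (x i) (y i)) := by
  congr 1
  funext u y
  simp only [messageChannel, mul_sum, sum_mul, ite_mul, zero_mul]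
  rw [sum_comm]
  simp [mul_assoc]

end MessageChannel

lemma LessNoisy.channelInfo_le {X Y Z : Type*} [Fintype X] [Fintype Y] [Fintype Z]
    {F : Channel X Z} {G : Channel X Y} (h : LessNoisy F G) {M M' n : ℕ} (hM : 0 < M)
    (hM' : 0 < M') (enc : Fin M → Fin M' → Fin n → X) :
    channelInfo (fun _ => (M : ℝ)⁻¹) (messageChannel G enc) ≤
      channelInfo (fun _ => (M : ℝ)⁻¹) (messageChannel F enc) := by
  classical
  rw [channelInfo_uniform hM _ (sum_messageChannel G enc hM'),
    channelInfo_uniform hM _ (sum_messageChannel F enc hM'), negCondEntropy_messageChannel,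
    negCondEntropy_messageChannel]
  refine add_le_add_left (h.negCondEntropy_block_le (Fin M) n _ fun u x => ?_) _
  exact sum_nonneg fun c _ => by split_ifs <;> positivity

/-! ### Rates and limits -/

lemma numMessages_pos (R : ℝ) (n : ℕ) : 0 < numMessages R n :=
  Nat.ceil_pos.2 (by positivity)

lemma mul_log_two_le_log_numMessages (R : ℝ) (n : ℕ) :
    n * R * log 2 ≤ log (numMessages R n) := by
  rw [← log_rpow two_pos]
  exact log_le_log (by positivity) (Nat.le_ceil _)

/-- A message set of rate `R'` below the information carried per super-letter: the union bound
of random coding tends to zero. -/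
lemma exists_rate_below {R' I : ℝ} {n : ℕ} (hn : 0 < n) (hR' : 0 ≤ R')
    (h : R' = 0 ∨ n * R' * log 2 < I) :
    ∃ γ < I, Tendsto (fun N : ℕ => ((numMessages R' N : ℝ) - 1) * exp (-((N / n : ℕ) * γ)))
      atTop (nhds 0) := by
  -- At rate zero there is a single message, so the union bound vanishes for any `γ`.
  rcases h with rfl | h
  · refine ⟨I - 1, by linarith, ?_⟩
    simp [numMessages]
  · obtain ⟨γ, h1, h2⟩ := exists_between h
    refine ⟨γ, h2, ?_⟩
    -- Since `N ≤ n * (N / n) + n` with floor division, the incomplete last super-letter costs only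
    -- the constant factor `exp (n * R' * log 2)`.
    have hlim : Tendsto (fun N : ℕ => exp (n * R' * log 2) *
        exp (-(((N / n : ℕ) : ℝ) * (γ - n * R' * log 2)))) atTop (nhds 0) := by
      rw [← mul_zero (exp (n * R' * log 2))]
      refine Tendsto.const_mul _ (tendsto_exp_neg_atTop_nhds_zero.comp ?_)
      exact ((tendsto_natCast_atTop_atTop.comp (Nat.tendsto_div_const_atTop hn.ne')).atTop_mul_const
        (sub_pos.2 h1))
    refine squeeze_zero (fun N => mul_nonneg ?_ (exp_pos _).le) (fun N => ?_) hlim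
    · have : (1 : ℝ) ≤ numMessages R' N := by exact_mod_cast numMessages_pos R' N
      linarith
    · have h3 : (numMessages R' N : ℝ) - 1 ≤ exp (N * R' * log 2) := by
        have := (Nat.ceil_lt_add_one (a := (2 : ℝ) ^ ((N : ℝ) * R')) (by positivity)).le
        rw [rpow_def_of_pos two_pos, mul_comm (log 2)] at this
        rw [numMessages, rpow_def_of_pos two_pos, mul_comm (log 2)]
        linarith
      have h4 : (N : ℝ) ≤ n * ((N / n : ℕ) : ℝ) + n := by
        exact_mod_cast (by
          rw [← Nat.mul_succ]; exact (Nat.lt_mul_div_succ N hn).le : N ≤ n * (N / n) + n)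
      have h5 : N * R' * log 2 ≤ (n * ((N / n : ℕ) : ℝ) + n) * R' * log 2 := by
        have := (log_pos one_lt_two).le
        gcongr
      calc _ ≤ exp ((n * ((N / n : ℕ) : ℝ) + n) * R' * log 2) * exp (-((N / n : ℕ) * γ)) := by
            gcongr
            exact h3.trans (exp_le_exp.2 h5)
        _ = _ := by
            rw [← exp_add, ← exp_add]
            congr 1
            ring

/-- Fano's bound eventually exceeds every rate below the rate of the code. -/
lemma eventually_rate_lt {R δ : ℝ} (hR : 0 ≤ R) (hδ : 0 < δ) {e : ℕ → ℝ}
    (he : Tendsto e atTop (nhds 0)) :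
    ∀ᶠ n : ℕ in atTop, ∀ I ε : ℝ, ε ≤ e n →
      log (numMessages R n) - ε * log (numMessages R n) - log 2 ≤ I →
        max (R - δ) 0 = 0 ∨ n * max (R - δ) 0 * log 2 < I := by
  have h1 : ∀ᶠ n in atTop, e n * R < δ / 2 :=
    (by simpa using he.mul_const R : Tendsto (fun n => e n * R) atTop (nhds 0)).eventually_lt_const
      (by positivity)
  have h2 : ∀ᶠ n in atTop, e n < 1 := he.eventually_lt_const one_pos
  have h3 : ∀ᶠ n : ℕ in atTop, 2 / δ < (n : ℝ) :=
    tendsto_natCast_atTop_atTop.eventually_gt_atTop _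
  filter_upwards [h1, h2, h3] with n h1 h2 h3 I ε hε hI
  rcases le_total (R - δ) 0 with h | h
  · exact Or.inl (max_eq_right h)
  right
  rw [max_eq_left h]
  have hl : 0 < log 2 := log_pos one_lt_two
  have h4 := mul_le_mul_of_nonneg_left (mul_log_two_le_log_numMessages R n)
    (by linarith : 0 ≤ 1 - ε)
  have hn : (0 : ℝ) < n := lt_trans (by positivity) h3
  -- Half of `δ` absorbs Fano's `log 2`; the other half absorbs the loss `ε * R`.
  have h5 : 1 < n * (δ / 2) := by
    rw [div_lt_iff₀ hδ] at h3
    linarith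
  have h6 : ε * R < δ / 2 := lt_of_le_of_lt (mul_le_mul_of_nonneg_right hε hR) h1
  have h7 : n * (ε * R) < n * (δ / 2) := mul_lt_mul_of_pos_left h6 hn
  have h8 : 0 < log 2 * (n * (δ / 2) - n * (ε * R) + (n * (δ / 2) - 1)) :=
    mul_pos hl (by linarith)
  nlinarith

/-! ### From a good code to achievability for the better receiver -/

theorem isAchievable_of_lessNoisy {X Y₁ Y₂ Z₂ : Type*} [Fintype X] [Fintype Y₁] [Fintype Y₂]
    [Fintype Z₂] {F₁ : Channel X Y₁} {F₂ : Channel X Z₂} {G₂ : Channel X Y₂}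
    (h : LessNoisy F₂ G₂) {W : Channel X (Y₁ × Y₂)} {W' : Channel X (Y₁ × Z₂)}
    (hW₁ : HasFstMarginal W F₁) (hW₂ : HasSndMarginal W G₂)
    (hW'₁ : HasFstMarginal W' F₁) (hW'₂ : HasSndMarginal W' F₂) {R : ℝ × ℝ}
    (hR : IsAchievable W R) {δ : ℝ} (hδ : 0 < δ) :
    IsAchievable W' (max (R.1 - δ) 0, max (R.2 - δ) 0) := by
  obtain ⟨hR₁, hR₂, c, hc⟩ := hR
  -- A letter for padding; the code of length one shows that `X` is inhabited.
  have x₀ : X := (c 1).enc (⟨0, numMessages_pos _ _⟩, ⟨0, numMessages_pos _ _⟩) 0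
  obtain ⟨n, hn₁, hn₂, hn⟩ := ((eventually_rate_lt hR₁ hδ hc).and
    ((eventually_rate_lt hR₂ hδ hc).and (eventually_gt_atTop 0))).exists
  set M₁ := numMessages R.1 n with hM₁
  set M₂ := numMessages R.2 n with hM₂
  have hM₁0 : 0 < M₁ := numMessages_pos _ _
  have hM₂0 : 0 < M₂ := numMessages_pos _ _
  let enc₁ : Fin M₁ → Fin M₂ → Fin n → X := fun a b => (c n).enc (a, b)
  let enc₂ : Fin M₂ → Fin M₁ → Fin n → X := fun b a => (c n).enc (a, b)
  have hI₁ := hn₁ _ _ (by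
      have := hW₁.error_le (c n)
      rwa [Fintype.sum_prod_type] at this)
    (channelInfo_messageChannel_ge F₁ enc₁ hM₁0 hM₂0 (c n).dec₁)
  -- Fano holds for the output of `G₂`; the less noisy order carries the bound over to `F₂`.
  have hI₂ := hn₂ _ _ (by
      have := hW₂.error_le (c n)
      rwa [Fintype.sum_prod_type, sum_comm, mul_comm (M₁ : ℝ)] at this)
    ((channelInfo_messageChannel_ge G₂ enc₂ hM₂0 hM₁0 (c n).dec₂).trans
      (h.channelInfo_le hM₂0 hM₁0 enc₂))
  obtain ⟨γ₁, hγ₁, hlim₁⟩ := exists_rate_below hn (le_max_right _ _) hI₁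
  obtain ⟨γ₂, hγ₂, hlim₂⟩ := exists_rate_below hn (le_max_right _ _) hI₂
  have hM₁' : (M₁ : ℝ) ≠ 0 := by positivity
  have hM₂' : (M₂ : ℝ) ≠ 0 := by positivity
  obtain ⟨ρ₁, ρ₂, hρ₁, hρ₁1, hρ₂, hρ₂1, hcode⟩ := exists_two_user_code
    (fun _ : Fin M₁ => (M₁ : ℝ)⁻¹) (fun _ => by positivity) (by simp [hM₁'])
    (fun _ : Fin M₂ => (M₂ : ℝ)⁻¹) (fun _ => by positivity) (by simp [hM₂'])
    (fun a b (y : Fin n → Y₁) => ∏ i, F₁ ((c n).enc (a, b) i) (y i))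
    (fun a b y => prod_channel_nonneg F₁ _ y) (fun a b => sum_prod_channel F₁ _)
    (fun a b (z : Fin n → Z₂) => ∏ i, F₂ ((c n).enc (a, b) i) (z i))
    (fun a b y => prod_channel_nonneg F₂ _ y) (fun a b => sum_prod_channel F₂ _)
    γ₁ γ₂ hγ₁ hγ₂
  have hex : ∀ N : ℕ, ∃ c' : Code X Y₁ Z₂ (numMessages (max (R.1 - δ) 0) N)
      (numMessages (max (R.2 - δ) 0) N) N, c'.errorProb W' ≤
        (ρ₁ ^ (N / n) + ((numMessages (max (R.1 - δ) 0) N : ℝ) - 1) *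
          exp (-((N / n : ℕ) * γ₁))) +
        (ρ₂ ^ (N / n) + ((numMessages (max (R.2 - δ) 0) N : ℝ) - 1) *
          exp (-((N / n : ℕ) * γ₂))) := by
    intro N
    obtain ⟨f, g, d₁, d₂, hfg⟩ := hcode (N / n) _ _
      (numMessages_pos (max (R.1 - δ) 0) N) (numMessages_pos (max (R.2 - δ) 0) N)
    -- The `N` time slots split into `N / n` super-letters and a padded remainder.
    let e : (Fin (N / n) × Fin n) ⊕ Fin (N % n) ≃ Fin N :=
      (finProdFinEquiv.sumCongr (Equiv.refl _)).trans
        (finSumFinEquiv.trans (finCongr (Nat.div_add_mod' N n)))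
    refine ⟨⟨fun m t => Sum.elim (fun p => (c n).enc (f m.1 p.1, g m.2 p.1) p.2) (fun _ => x₀)
      (e.symm t), fun y => d₁ fun i j => y (e (Sum.inl (i, j))),
      fun y => d₂ fun i j => y (e (Sum.inl (i, j)))⟩, ?_⟩
    refine (errorProb_le_add hW'₁ hW'₂ _).trans (le_trans (le_of_eq ?_) hfg)
    congr 1
    refine sum_congr rfl fun m _ => ?_
    congr 1
    · exact decodingError_pad F₁ e (fun i j => (c n).enc (f m.1 i, g m.2 i) j) x₀ d₁ m.1
    · exact decodingError_pad F₂ e (fun i j => (c n).enc (f m.1 i, g m.2 i) j) x₀ d₂ m.2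
  choose c' hc' using hex
  refine ⟨le_max_right _ _, le_max_right _ _, c',
    squeeze_zero (fun N => errorProb_nonneg W' _) hc' ?_⟩
  have hdiv := Nat.tendsto_div_const_atTop hn.ne'
  simpa using (((tendsto_pow_atTop_nhds_zero_of_lt_one hρ₁ hρ₁1).comp hdiv).add hlim₁).add
    (((tendsto_pow_atTop_nhds_zero_of_lt_one hρ₂ hρ₂1).comp hdiv).add hlim₂)

end BroadcastChannel

theorem mainTheorem12 {X : Type u} {Y₂ : Type v} {Z₂ : Type v'}
    [Fintype X] [Fintype Y₂] [Fintype Z₂]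
    (F₂ : BroadcastChannel.Channel X Z₂) (G₂ : BroadcastChannel.Channel X Y₂)
    (h : BroadcastChannel.LessNoisy F₂ G₂) :
    BroadcastChannel.BetterReceiver.{u, v, v', w} F₂ G₂ := by
  intro Y₁ _ F₁ W W' hW₁ hW₂ hW'₁ hW'₂
  refine closure_minimal (fun R hR => Metric.mem_closure_iff.2 fun ε hε => ?_) isClosed_closure
  refine ⟨_, BroadcastChannel.isAchievable_of_lessNoisy h hW₁ hW₂ hW'₁ hW'₂ hR (half_pos hε), ?_⟩
  have key : ∀ r : ℝ, 0 ≤ r → dist r (max (r - ε / 2) 0) < ε := by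
    intro r hr
    rw [Real.dist_eq, abs_lt]
    rcases max_cases (r - ε / 2) 0 with ⟨h1, h2⟩ | ⟨h1, h2⟩ <;> rw [h1] <;>
      constructor <;> linarith
  rw [Prod.dist_eq]
  exact max_lt (key _ hR.1) (key _ hR.2.1)
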